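/- **Theorem 2.3.** Let $\mathcal H$ be a complex Hilbert space, let $\mathcal A\subseteq B(\mathcal H)$ be a von Neumann algebra and let $\tau:\mathcal A\to\mathcal A$ be a normal unital completely positive map. Let $(\mathcal K,\mathcal B,\theta)$ be the minimal dilation of $\tau$. That is: $\mathcal K$ is a Hilbert space containing $\mathcal H$ as a closed subspace, $p$ is the orthogonal projection of $\mathcal K$ onto $\mathcal H$, and each $x\in B(\mathcal H)$ is identified with $pxp\in B(\mathcal K)$; $\mathcal B\subseteq B(\mathcal K)$ is a von Neumann algebra with $\mathcal A\subseteq\mathcal B$ and $\mathcal A=p\mathcal Bp$; $\theta:\mathcal B\to\mathcal B$ is a normal unital $*$-endomorphism with $$\tau^n(x)=p\,\theta^n(x)\,p\qquad(x\in\mathcal A,\ n\ge 0);$$ the linear span of the vectors $\theta^n(x_n)\theta^{n-1}(x_{n-1})\cdots\theta(x_1)h$ with $n\ge 0$, $x_1,\dots,x_n\in\mathcal A$, $h\in\mathcal H$ is dense in $\mathcal K$; and $\mathcal B$ is the von Neumann algebra generated by $\{\theta^n(x): n\ge 0,\ x\in\mathcal A\}$. For a linear map $\varphi:\mathcal M\to\mathcal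 M$ on a von Neumann algebra $\mathcal M$ put $$\mathcal P(\varphi)=\overline{\operatorname{span}}\{x\in\mathcal M:\ \varphi(x)=\lambda x\ \text{for some }\lambda\in\mathbb C,\ |\lambda|=1\},$$ the closure being taken in the operator norm. Then the compression $z\mapsto pzp$ is a completely positive map from $\mathcal B$ to $\mathcal A$; $\mathcal P(\theta)$ is a unital $C^*$-subalgebra of $\mathcal B$; and the restriction $T$ of the compression to $\mathcal P(\theta)$ is an isometric linear bijection from $\mathcal P(\theta)$ onto $\mathcal P(\tau)$. In particular, the product $$x\circ y:=T\bigl(T^{-1}(x)\,T^{-1}(y)\bigr),\qquad x,y\in\mathcal P(\tau),$$ together with the linear structure, the involution, the norm and the unit that $\mathcal P(\tau)$ inherits from $\mathcal A$, makes $\mathcal P(\tau)$ a unital $C^*$-algebra. -/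

import Mathlib

open scoped CStarAlgebra

/-! ### The C⋆-algebra and the order carried by a von Neumann algebra -/

/-- The type of elements of a (concrete) von Neumann algebra. -/
abbrev VonNeumannAlgebra.Elem {H : Type*} [NormedAddCommGroup H] [InnerProductSpace ℂ H]
    [CompleteSpace H] (A : VonNeumannAlgebra H) : Type _ :=
  A.toStarSubalgebra

/-- A von Neumann algebra is norm closed, hence a C⋆-algebra for the operator norm. -/
instance VonNeumannAlgebra.instIsClosedCoe {H : Type*} [NormedAddCommGroup H]
    [InnerProductSpace ℂ H] [CompleteSpace H] (A : VonNeumannAlgebra H) :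
    IsClosed (A.toStarSubalgebra : Set (H →L[ℂ] H)) := by
  have h := A.centralizer_centralizer
  rw [VonNeumannAlgebra.coe_toStarSubalgebra, ← h]
  exact Set.isClosed_centralizer _

/-- The order of a von Neumann algebra is the Loewner order of operators: `x ≤ y` means that
`y - x` is a positive operator. -/
noncomputable instance VonNeumannAlgebra.instPartialOrderElem {H : Type*} [NormedAddCommGroup H]
    [InnerProductSpace ℂ H] [CompleteSpace H] (A : VonNeumannAlgebra H) :
    PartialOrder A.Elem :=
  Subtype.partialOrder _

instance VonNeumannAlgebra.instStarOrderedRingElem {H : Type*} [NormedAddCommGroup H]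
    [InnerProductSpace ℂ H] [CompleteSpace H] (A : VonNeumannAlgebra H) :
    StarOrderedRing A.Elem := by
  have key : ∀ x : A.Elem, 0 ≤ x ↔ ∃ s, x = star s * s := by
    intro x
    constructor
    · intro hx
      have hx' : (0 : H →L[ℂ] H) ≤ (x : H →L[ℂ] H) := hx
      have hsa : IsSelfAdjoint x := Subtype.ext (IsSelfAdjoint.of_nonneg hx')
      let _ := CStarAlgebra.spectralOrder A.Elem
      have := CStarAlgebra.spectralOrderedRing A.Elem
      rw [← CStarAlgebra.nonneg_iff_eq_star_mul_self,
        StarOrderedRing.nonneg_iff_spectrum_nonneg (R := ℝ) x hsa]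
      intro r hr
      refine (StarOrderedRing.nonneg_iff_spectrum_nonneg (R := ℝ) (x : H →L[ℂ] H)
        (IsSelfAdjoint.of_nonneg hx')).1 hx' r ?_
      rw [← spectrum.algebraMap_mem_iff ℂ] at hr ⊢
      exact StarSubalgebra.mem_spectrum_iff A.toStarSubalgebra |>.1 hr
    · rintro ⟨s, rfl⟩
      exact star_mul_self_nonneg (s : H →L[ℂ] H)
  refine StarOrderedRing.of_nonneg_iff' ?_ key
  intro x y hxy z
  exact add_le_add_right (α := H →L[ℂ] H) hxy z

/-! ### Peripheral eigenvectors -/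

/-- The norm closure of the linear span of the peripheral eigenvectors of `φ`, that is, of all
`x` with `φ x = λ x` for some complex number `λ` of modulus one. -/
noncomputable def peripheralSpace {M : Type*} [CStarAlgebra M] (φ : M → M) : Submodule ℂ M :=
  (Submodule.span ℂ {x : M | ∃ c : ℂ, ‖c‖ = 1 ∧ φ x = c • x}).topologicalClosure

section Dilation

variable {H K : Type*} [NormedAddCommGroup H] [InnerProductSpace ℂ H] [CompleteSpace H]
  [NormedAddCommGroup K] [InnerProductSpace ℂ K] [CompleteSpace K]

/-- The operator `V x V⋆` on `K` with which an operator `x` on `H` is identified, when `H` is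
regarded as a closed subspace of `K` through the isometry `V`. -/
noncomputable def extendByZero (V : H →ₗᵢ[ℂ] K) (x : H →L[ℂ] H) : K →L[ℂ] K :=
  V.toContinuousLinearMap ∘L x ∘L V.toContinuousLinearMap.adjoint

/-- The compression `V⋆ z V` to `H` of an operator `z` on `K`. Under the identification
`extendByZero` it is the operator `p z p`. -/
noncomputable def compression (V : H →ₗᵢ[ℂ] K) (z : K →L[ℂ] K) : H →L[ℂ] H :=
  V.toContinuousLinearMap.adjoint ∘L z ∘L V.toContinuousLinearMap

/-- The orthogonal projection `p = V V⋆` of `K` onto the closed subspace `H`. -/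
noncomputable def rangeProj (V : H →ₗᵢ[ℂ] K) : K →L[ℂ] K :=
  V.toContinuousLinearMap ∘L V.toContinuousLinearMap.adjoint

/-- The inclusion `A ⊆ B`, `x ↦ V x V⋆`, between elements of von Neumann algebras on `H` and
on `K`. -/
noncomputable def includeElem {A : VonNeumannAlgebra H} {B : VonNeumannAlgebra K}
    (V : H →ₗᵢ[ℂ] K) (hAB : ∀ x ∈ A, extendByZero V x ∈ B) (x : A.Elem) : B.Elem :=
  ⟨extendByZero V x, hAB x x.2⟩

/-- The vector `θⁿ(x_n) θⁿ⁻¹(x_{n-1}) ⋯ θ(x_1) h` of `K`, for `x_1, …, x_n` in `A` and `h` in `H`;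
it is `h` itself for `n = 0`. -/
noncomputable def dilationVector {A : VonNeumannAlgebra H} {B : VonNeumannAlgebra K}
    (V : H →ₗᵢ[ℂ] K) (hAB : ∀ x ∈ A, extendByZero V x ∈ B) (θ : B.Elem → B.Elem)
    (x : ℕ → A.Elem) (h : H) : ℕ → K
  | 0 => V h
  | n + 1 => (θ^[n + 1] (includeElem V hAB (x (n + 1))) : K →L[ℂ] K)
      (dilationVector V hAB θ x h n)

/-- The triple `(K, B, θ)` is a minimal dilation of the map `τ` on `A ⊆ B(H)`, where `H` is
regarded as a closed subspace of `K` through the isometry `V`. -/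
structure IsMinimalDilation (A : VonNeumannAlgebra H) (τ : A.Elem → A.Elem)
    (V : H →ₗᵢ[ℂ] K) (B : VonNeumannAlgebra K) (θ : B.Elem →⋆ₐ[ℂ] B.Elem) : Prop where
  /-- `A ⊆ B` -/
  subset : ∀ x ∈ A, extendByZero V x ∈ B
  /-- `A = p B p` -/
  corner : extendByZero V '' (A : Set (H →L[ℂ] H)) =
    {y : K →L[ℂ] K | ∃ b ∈ B, y = rangeProj V * b * rangeProj V}
  /-- the unital `⋆`-endomorphism `θ` is normal -/
  normal : ScottContinuous θ
  /-- `τⁿ(x) = p θⁿ(x) p` -/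
  dilation : ∀ (n : ℕ) (x : A.Elem), extendByZero V (τ^[n] x : A.Elem) =
    rangeProj V * (θ^[n] (includeElem V subset x) : B.Elem) * rangeProj V
  /-- minimality of the space -/
  dense : (Submodule.span ℂ {v : K | ∃ (n : ℕ) (x : ℕ → A.Elem) (h : H),
    v = dilationVector V subset θ x h n}).topologicalClosure = ⊤
  /-- minimality of the algebra: `B` is the smallest von Neumann algebra on `K` that contains
  all `θⁿ(x)` with `x` in `A` -/
  generates : ∀ C : VonNeumannAlgebra K,
    (∀ (n : ℕ) (x : A.Elem), ((θ^[n] (includeElem V subset x) : B.Elem) : K →L[ℂ] K) ∈ C) → B ≤ C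

end Dilation

/-! ### A new product on a subspace of a C⋆-algebra -/

/-- The linear structure, the involution, the norm and the unit of the C⋆-algebra `C` are those
inherited from `M` along `j`, and the product of `C` is `op`. -/
structure InheritsExceptProduct {M C : Type*} [CStarAlgebra M] [CStarAlgebra C] (j : C → M)
    (op : C → C → C) : Prop where
  add : ∀ a b : C, j (a + b) = j a + j b
  smul : ∀ (c : ℂ) (a : C), j (c • a) = c • j a
  star : ∀ a : C, j (star a) = star (j a)
  norm : ∀ a : C, ‖a‖ = ‖j a‖
  one : j 1 = 1
  mul : ∀ a b : C, a * b = op a b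

/-- The product `op`, together with the linear structure, the involution, the norm and the unit
of `M`, makes the subspace `P` of `M` a unital C⋆-algebra. -/
def IsUnitalCStarProduct {M : Type*} [CStarAlgebra M] (P : Submodule ℂ M) (op : P → P → P) :
    Prop :=
  ∃ alg : CStarAlgebra P, @InheritsExceptProduct M P _ alg Subtype.val op

/-!
Write `p` for the projection of `K` onto `H`, and `q n = θⁿ(p)`. Since `τ` is unital, `p ≤ θ(p)`, so
the projections `q n` increase; the vector `θⁿ(x_n) ⋯ θ(x_1) h` lies in the range of `q n`, so by
minimality of `K` an operator is controlled by its compressions `q n * z * q n`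
(`IsMinimalDilation.norm_le_of_forall_projSeq`). Two arguments rest on this.

* The compression is isometric on `P(θ)`
  (`IsMinimalDilation.norm_compressionₗ_of_mem_peripheralSpace`). If `z` is a finite sum of
  peripheral eigenvectors of `θ`, then `θᵐ(z)` returns arbitrarily close to `z`, because the powers
  of finitely many unimodular numbers recur simultaneously (`mapClusterPt_iterate_of_mem_span`). As
  `q m * θᵐ(z) * q m = θᵐ(p z p)` has norm at most `‖p z p‖`, so does every `q n * z * q n`.
* The compression maps `P(θ)` onto `P(τ)` (`IsMinimalDilation.map_peripheralSpace`). If `τ x = c x`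
  with `|c| = 1`, put `y n = c⁻ⁿ θⁿ(x)`. The dilation identity gives `q n * y m * q n = y n` for
  `n ≤ m`, so a weak cluster point `z` of this bounded sequence satisfies `q n * z * q n = y n` for
  all `n`. These equations determine `z`; they show that `z` commutes with the commutant of `B`,
  that `θ z = c z`, and that `p z p = x`.

Products and adjoints of peripheral eigenvectors of a `⋆`-endomorphism are again such eigenvectors,
so `P(θ)` is a C⋆-algebra, and its structure is carried over to `P(τ)`. Complete positivity of the
compression is proved with square roots of positive matrices over the corner `p B p`, on which the
compression is multiplicative.
-/

/-! ### Weak cluster points and compressions by projections -/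

section Operators

open Filter Topology

variable {K : Type*} [NormedAddCommGroup K] [InnerProductSpace ℂ K] [CompleteSpace K]

/-- Weak operator compactness of bounded sets of operators: a norm bounded sequence converges
weakly along an ultrafilter finer than `atTop`. -/
theorem ContinuousLinearMap.exists_tendsto_inner_hyperfilter (y : ℕ → K →L[ℂ] K) (C : ℝ)
    (hy : ∀ n, ‖y n‖ ≤ C) :
    ∃ z : K →L[ℂ] K, ∀ v w : K,
      Tendsto (fun n => inner ℂ (y n v) w) (hyperfilter ℕ : Filter ℕ) (𝓝 (inner ℂ (z v) w)) := by
  have hbound : ∀ n v w, ‖inner ℂ (y n v) w‖ ≤ C * ‖v‖ * ‖w‖ := fun n v w =>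
    (norm_inner_le_norm _ _).trans <| by
      gcongr
      exact (y n).le_of_opNorm_le (hy n) v
  have hlim : ∀ v w, ∃ l : ℂ, ‖l‖ ≤ C * ‖v‖ * ‖w‖ ∧
      Tendsto (fun n => inner ℂ (y n v) w) (hyperfilter ℕ : Filter ℕ) (𝓝 l) := by
    intro v w
    obtain ⟨l, hl, hl'⟩ := (isCompact_closedBall (0 : ℂ) (C * ‖v‖ * ‖w‖)).ultrafilter_le_nhds
      ((hyperfilter ℕ).map fun n => inner ℂ (y n v) w)
      (le_principal_iff.2 <| Ultrafilter.mem_map.2 <| univ_mem' fun n => by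
        simpa using hbound n v w)
    exact ⟨l, by simpa using hl, hl'⟩
  choose L hL hLt using hlim
  let f : K →ₗ⋆[ℂ] K →ₗ[ℂ] ℂ := LinearMap.mk₂'ₛₗ (starRingEnd ℂ) (RingHom.id ℂ) L
    (fun v₁ v₂ w => tendsto_nhds_unique (hLt _ _) <| by
      simpa [inner_add_left] using (hLt v₁ w).add (hLt v₂ w))
    (fun c v w => tendsto_nhds_unique (hLt _ _) <| by
      simpa [inner_smul_left, mul_comm] using (hLt v w).const_mul (starRingEnd ℂ c))
    (fun v w₁ w₂ => tendsto_nhds_unique (hLt _ _) <| by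
      simpa [inner_add_right] using (hLt v w₁).add (hLt v w₂))
    (fun c v w => tendsto_nhds_unique (hLt _ _) <| by
      simpa [inner_smul_right] using (hLt v w).const_mul c)
  refine ⟨InnerProductSpace.continuousLinearMapOfBilin (f.mkContinuous₂ C hL), fun v w => ?_⟩
  rw [InnerProductSpace.continuousLinearMapOfBilin_apply]
  exact hLt v w

/-- If the ranges of an increasing sequence of projections `q n` span a dense subspace, the norm
of an operator is controlled by the norms of its compressions `q n * z * q n`. -/
theorem ContinuousLinearMap.opNorm_le_of_forall_compression_le {q : ℕ → K →L[ℂ] K}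
    (hsa : ∀ n, star (q n) = q n) (hq : ∀ n m, n ≤ m → q m * q n = q n)
    (hdense : Dense ((⨆ n, (q n).range : Submodule ℂ K) : Set K)) {z : K →L[ℂ] K} {C : ℝ}
    (hC : 0 ≤ C) (hz : ∀ n, ‖q n * z * q n‖ ≤ C) : ‖z‖ ≤ C := by
  have hmono : Monotone fun n => (q n).range := by
    rintro n m hnm _ ⟨v, rfl⟩
    exact ⟨q n v, by simpa using congr($(hq n m hnm) v)⟩
  have key : ∀ v w : K, ‖inner ℂ v (z w)‖ ≤ C * ‖v‖ * ‖w‖ := by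
    refine fun v w => isClosed_property2 (e := ((↑) : (⨆ n, (q n).range : Submodule ℂ K) → K))
      (p := fun v w => ‖inner ℂ v (z w)‖ ≤ C * ‖v‖ * ‖w‖) hdense.denseRange_val
      (isClosed_le (by fun_prop) (by fun_prop)) ?_ v w
    rintro ⟨v, hv⟩ ⟨w, hw⟩
    obtain ⟨n, hn⟩ := (Submodule.mem_iSup_of_directed _ hmono.directed_le).1 hv
    obtain ⟨m, hm⟩ := (Submodule.mem_iSup_of_directed _ hmono.directed_le).1 hw
    have hfix : ∀ u ∈ (q (max n m)).range, q (max n m) u = u := by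
      rintro _ ⟨u, rfl⟩
      simpa using congr($(hq _ _ (le_refl (max n m))) u)
    have hv' := hfix v (hmono (le_max_left n m) hn)
    have hw' := hfix w (hmono (le_max_right n m) hm)
    set r := q (max n m) with hr
    have hrs : ContinuousLinearMap.adjoint r = r := hsa _
    have : inner ℂ v (z w) = inner ℂ v ((r * z * r) w) := by
      simp only [mul_apply_eq_comp, hw']
      rw [← ContinuousLinearMap.adjoint_inner_left r, hrs, hv']
    simp only [this]
    calc _ ≤ ‖v‖ * ‖(r * z * r) w‖ := norm_inner_le_norm _ _
      _ ≤ ‖v‖ * (C * ‖w‖) := by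
        gcongr
        exact ContinuousLinearMap.le_of_opNorm_le _ (hz _) w
      _ = C * ‖v‖ * ‖w‖ := by ring
  refine ContinuousLinearMap.opNorm_le_bound _ hC fun w => ?_
  have := key (z w) w
  rw [inner_self_eq_norm_sq_to_K, norm_pow, RCLike.norm_ofReal, abs_norm] at this
  rcases eq_or_ne (z w) 0 with h | h
  · rw [h, norm_zero]; positivity
  · refine le_of_mul_le_mul_left ?_ (norm_pos_iff.2 h)
    linarith

end Operators

/-! ### Peripheral eigenvectors -/

section Peripheral

open Filter Topology

/-- Powers of unimodular numbers recur simultaneously: if `φ` is linear, every `z` in the span of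
its peripheral eigenvectors is a cluster point of its own orbit. -/
theorem mapClusterPt_iterate_of_mem_span {M : Type*} [CStarAlgebra M] (φ : M →ₗ[ℂ] M) {z : M}
    (hz : z ∈ Submodule.span ℂ {x : M | ∃ c : ℂ, ‖c‖ = 1 ∧ φ x = c • x}) :
    MapClusterPt z atTop (fun n : ℕ => (φ ^ n) z) := by
  -- The orbit is the image of the powers of the identity map, a point of the compact group
  -- `Circle → Circle`, under a continuous map `F` with `F 1 = z`.
  have key : ∃ F : (Circle → Circle) → M, Continuous F ∧ F 1 = z ∧
      ∀ n : ℕ, (φ ^ n) z = F ((id : Circle → Circle) ^ n) := by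
    induction hz using Submodule.span_induction with
    | mem x hx =>
      obtain ⟨c, hc, hx⟩ := hx
      let c' : Circle := ⟨c, mem_sphere_zero_iff_norm.2 hc⟩
      refine ⟨fun χ => ((χ c' : Circle) : ℂ) • x, by fun_prop, by simp, fun n => ?_⟩
      have hc' : ((((id : Circle → Circle) ^ n) c' : Circle) : ℂ) = c ^ n := by
        rw [Pi.pow_apply]
        exact Circle.coe_pow _ _
      have hxn : (φ ^ n) x = c ^ n • x := by
        clear hc'
        induction n with
        | zero => simp
        | succ n ih =>
          rw [pow_succ, Module.End.mul_apply, hx, map_smul, ih, smul_smul, pow_succ']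
      exact hxn.trans congr($hc'.symm • x)
    | zero => exact ⟨fun _ => 0, continuous_const, rfl, by simp⟩
    | add x y _ _ hx hy =>
      obtain ⟨F, hF, hF1, hFn⟩ := hx
      obtain ⟨G, hG, hG1, hGn⟩ := hy
      exact ⟨fun χ => F χ + G χ, hF.add hG, by simp [hF1, hG1], by simp [hFn, hGn]⟩
    | smul a x _ hx =>
      obtain ⟨F, hF, hF1, hFn⟩ := hx
      exact ⟨fun χ => a • F χ, hF.const_smul a, by simp [hF1], by simp [hFn]⟩
  obtain ⟨F, hF, hF1, hFn⟩ := key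
  have := (mapClusterPt_one_atTop_pow (id : Circle → Circle)).continuousAt_comp hF.continuousAt
  rw [hF1] at this
  convert this using 1
  ext n
  exact hFn n

/-- The closed span of the peripheral eigenvectors of a unital `⋆`-endomorphism is a unital
`⋆`-subalgebra, because these eigenvectors are closed under products and adjoints. -/
noncomputable def peripheralStarSubalgebra {M : Type*} [CStarAlgebra M] (θ : M →⋆ₐ[ℂ] M) :
    StarSubalgebra ℂ M where
  toSubalgebra := (peripheralSpace θ).toSubalgebra
    (subset_closure (Submodule.subset_span ⟨1, by simp⟩))
    fun a b ha hb => map_mem_closure₂ continuous_mul ha hb fun a ha b hb => by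
      have h := Submodule.mul_mem_mul ha hb
      rw [Submodule.span_mul_span] at h
      refine Submodule.span_mono ?_ h
      rintro _ ⟨x, ⟨c, hc, hx⟩, y, ⟨d, hd, hy⟩, rfl⟩
      exact ⟨c * d, by simp [hc, hd], by simp [hx, hy, smul_smul, mul_comm]⟩
  star_mem' {a} ha := map_mem_closure continuous_star ha fun a ha => by
    induction ha using Submodule.span_induction with
    | mem x hx =>
      obtain ⟨c, hc, hx⟩ := hx
      exact Submodule.subset_span ⟨star c, by simpa using hc, by rw [map_star, hx, star_smul]⟩
    | zero => simp
    | add x y _ _ hx hy => rw [star_add]; exact add_mem hx hy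
    | smul a x _ hx => rw [star_smul]; exact Submodule.smul_mem _ _ hx

end Peripheral

/-! ### Transport of a C⋆-algebra structure -/

/-- A `⋆`-preserving unital linear isometry of a C⋆-algebra onto a subspace `P` of another one
turns `P` into a C⋆-algebra. -/
theorem isUnitalCStarProduct_of_linearIsometryEquiv {M S : Type*} [CStarAlgebra M] [CStarAlgebra S]
    (P : Submodule ℂ M) (T : S ≃ₗᵢ[ℂ] P) (hone : (T 1 : M) = 1)
    (hstar : ∀ a, (T (star a) : M) = star (T a : M)) :
    IsUnitalCStarProduct P fun x y => T (T.symm x * T.symm y) := by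
  have hstar' : ∀ x : P, star (x : M) ∈ P := fun x => by
    have h := hstar (T.symm x)
    rw [T.apply_symm_apply] at h
    exact h ▸ (T (star (T.symm x))).2
  let : Mul P := ⟨fun x y => T (T.symm x * T.symm y)⟩
  let : One P := ⟨T 1⟩
  let : Star P := ⟨fun x => ⟨star (x : M), hstar' x⟩⟩
  have hmul : ∀ x y : P, T.symm (x * y) = T.symm x * T.symm y := fun x y => T.symm_apply_apply _
  have hone' : T.symm (1 : P) = 1 := T.symm_apply_apply _
  have hst : ∀ x : P, T.symm (star x) = star (T.symm x) := fun x => by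
    rw [LinearIsometryEquiv.symm_apply_eq]
    exact Subtype.ext (by rw [hstar, T.apply_symm_apply]; rfl)
  let ring : Ring P :=
    { (inferInstance : AddCommGroup P) with
      mul_assoc := fun x y z => T.symm.injective (by simp [hmul, mul_assoc])
      one_mul := fun x => T.symm.injective (by simp [hmul, hone'])
      mul_one := fun x => T.symm.injective (by simp [hmul, hone'])
      left_distrib := fun x y z => T.symm.injective (by simp [hmul, mul_add])
      right_distrib := fun x y z => T.symm.injective (by simp [hmul, add_mul])
      zero_mul := fun x => T.symm.injective (by simp [hmul])
      mul_zero := fun x => T.symm.injective (by simp [hmul]) }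
  let nring : NormedRing P :=
    { ring, (inferInstance : NormedAddCommGroup P) with
      norm_mul_le := fun x y => by
        rw [← T.symm.norm_map, hmul, ← T.symm.norm_map x, ← T.symm.norm_map y]
        exact norm_mul_le _ _ }
  let sring : StarRing P :=
    { star_involutive := fun x => Subtype.ext (star_star (x : M))
      star_mul := fun x y => T.symm.injective (by rw [hst, hmul, hmul, hst, hst, star_mul])
      star_add := fun x y => Subtype.ext (star_add (x : M) y) }
  let alg : Algebra ℂ P := Algebra.ofModule
    (fun c x y => T.symm.injective (by rw [hmul, map_smul, map_smul, hmul, smul_mul_assoc]))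
    (fun c x y => T.symm.injective (by rw [hmul, map_smul, map_smul, hmul, mul_smul_comm]))
  let nalg : NormedAlgebra ℂ P :=
    { alg with norm_smul_le := fun c x => norm_smul_le c (x : M) }
  let cstar : CStarAlgebra P := { nring, sring, nalg with
    complete := (T.toIsometryEquiv.completeSpace_iff.1 inferInstance : CompleteSpace P).complete
    norm_mul_self_le := fun x => by
      rw [← T.symm.norm_map, ← T.symm.norm_map, hmul, hst]
      exact CStarRing.norm_mul_self_le _
    star_smul := fun c x => Subtype.ext (star_smul c (x : M)) }
  exact ⟨cstar, ⟨fun _ _ => rfl, fun _ _ => rfl, fun _ => rfl, fun _ => rfl, hone, fun _ _ => rfl⟩⟩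

/-! ### Compression to the subspace -/

theorem CStarAlgebra.exists_isSelfAdjoint_mul_self_eq {C : Type*} [NonUnitalCStarAlgebra C]
    [PartialOrder C] [StarOrderedRing C] {a : C} (ha : 0 ≤ a) :
    ∃ s : C, star s = s ∧ s * s = a :=
  ⟨CFC.sqrt a, (CFC.sqrt_nonneg a).isSelfAdjoint, CFC.sqrt_mul_sqrt_self a ha⟩

section Compression

variable {H K : Type*} [NormedAddCommGroup H] [InnerProductSpace ℂ H] [CompleteSpace H]
  [NormedAddCommGroup K] [InnerProductSpace ℂ K] [CompleteSpace K] (V : H →ₗᵢ[ℂ] K)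

theorem LinearIsometry.adjoint_apply_self (h : H) :
    V.toContinuousLinearMap.adjoint (V h) = h := by
  have h1 := (ContinuousLinearMap.norm_map_iff_adjoint_comp_self V.toContinuousLinearMap).1
    V.norm_map
  exact congr($h1 h)

theorem compression_extendByZero (x : H →L[ℂ] H) : compression V (extendByZero V x) = x := by
  ext h
  simp [compression, extendByZero, V.adjoint_apply_self]

theorem extendByZero_compression (z : K →L[ℂ] K) :
    extendByZero V (compression V z) = rangeProj V * z * rangeProj V := by
  ext h
  simp [compression, extendByZero, rangeProj]

theorem extendByZero_injective : Function.Injective (extendByZero V) :=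
  Function.LeftInverse.injective (compression_extendByZero V)

theorem extendByZero_one : extendByZero V 1 = rangeProj V := by
  ext h
  simp [extendByZero, rangeProj]

theorem extendByZero_smul (c : ℂ) (x : H →L[ℂ] H) :
    extendByZero V (c • x) = c • extendByZero V x := by
  ext h
  simp [extendByZero]

theorem extendByZero_mul (x y : H →L[ℂ] H) :
    extendByZero V (x * y) = extendByZero V x * extendByZero V y := by
  ext h
  simp [extendByZero, V.adjoint_apply_self]

theorem star_extendByZero (x : H →L[ℂ] H) :
    star (extendByZero V x) = extendByZero V (star x) := by
  simp [extendByZero, ContinuousLinearMap.star_eq_adjoint, ContinuousLinearMap.adjoint_comp,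
    ContinuousLinearMap.comp_assoc]

theorem star_compression (z : K →L[ℂ] K) : star (compression V z) = compression V (star z) := by
  simp [compression, ContinuousLinearMap.star_eq_adjoint, ContinuousLinearMap.adjoint_comp,
    ContinuousLinearMap.comp_assoc]

theorem compression_mul_rangeProj_mul (y z : K →L[ℂ] K) :
    compression V (y * rangeProj V * z) = compression V y * compression V z := by
  ext h
  simp [compression, rangeProj]

theorem rangeProj_mul_self : rangeProj V * rangeProj V = rangeProj V := by
  rw [← extendByZero_one, ← extendByZero_mul, one_mul]

theorem star_rangeProj : star (rangeProj V) = rangeProj V := by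
  rw [← extendByZero_one, star_extendByZero, star_one]

theorem compression_one : compression V 1 = 1 := by
  ext h
  simp [compression, V.adjoint_apply_self]

end Compression

namespace IsMinimalDilation

variable {H K : Type*} [NormedAddCommGroup H] [InnerProductSpace ℂ H] [CompleteSpace H]
  [NormedAddCommGroup K] [InnerProductSpace ℂ K] [CompleteSpace K]
  {A : VonNeumannAlgebra H} {τ : A.Elem → A.Elem} {V : H →ₗᵢ[ℂ] K} {B : VonNeumannAlgebra K}
  {θ : B.Elem →⋆ₐ[ℂ] B.Elem}

theorem compression_mem (hdil : IsMinimalDilation A τ V B θ) (z : B.Elem) :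
    compression V (z : K →L[ℂ] K) ∈ A := by
  have h : rangeProj V * (z : K →L[ℂ] K) * rangeProj V ∈
      {y : K →L[ℂ] K | ∃ b ∈ B, y = rangeProj V * b * rangeProj V} := ⟨z, z.2, rfl⟩
  rw [← hdil.corner] at h
  obtain ⟨x, hx, hxz⟩ := h
  rw [← extendByZero_compression] at hxz
  rwa [← extendByZero_injective V hxz]

/-- The compression `z ↦ p z p` as a linear map from `B` to `A`. -/
noncomputable def compressionₗ (hdil : IsMinimalDilation A τ V B θ) : B.Elem →ₗ[ℂ] A.Elem where
  toFun z := ⟨compression V z, hdil.compression_mem z⟩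
  map_add' y z := Subtype.ext (by ext h; simp [compression])
  map_smul' c z := Subtype.ext (by ext h; simp [compression])

/-- The projection `p` of `K` onto `H`, as an element of `B`. -/
noncomputable def proj (hdil : IsMinimalDilation A τ V B θ) : B.Elem :=
  includeElem V hdil.subset 1

theorem coe_proj (hdil : IsMinimalDilation A τ V B θ) :
    (hdil.proj : K →L[ℂ] K) = rangeProj V := extendByZero_one V

theorem proj_mul_self (hdil : IsMinimalDilation A τ V B θ) : hdil.proj * hdil.proj = hdil.proj :=
  Subtype.ext (by simpa [coe_proj] using rangeProj_mul_self V)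

theorem star_proj (hdil : IsMinimalDilation A τ V B θ) : star hdil.proj = hdil.proj :=
  Subtype.ext (by simpa [coe_proj] using star_rangeProj V)

theorem compressionₗ_mul_proj_mul (hdil : IsMinimalDilation A τ V B θ) (y z : B.Elem) :
    hdil.compressionₗ (y * hdil.proj * z) = hdil.compressionₗ y * hdil.compressionₗ z :=
  Subtype.ext (by
    simpa [compressionₗ, coe_proj] using compression_mul_rangeProj_mul V (y : K →L[ℂ] K) z)

theorem star_compressionₗ (hdil : IsMinimalDilation A τ V B θ) (z : B.Elem) :
    star (hdil.compressionₗ z) = hdil.compressionₗ (star z) :=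
  Subtype.ext (star_compression V _)

theorem compressionₗ_one (hdil : IsMinimalDilation A τ V B θ) : hdil.compressionₗ 1 = 1 :=
  Subtype.ext (compression_one V)

theorem includeElem_compressionₗ (hdil : IsMinimalDilation A τ V B θ) (z : B.Elem) :
    includeElem V hdil.subset (hdil.compressionₗ z) = hdil.proj * z * hdil.proj :=
  Subtype.ext (by
    simpa [coe_proj] using! extendByZero_compression V (z : K →L[ℂ] K))

theorem compressionₗ_includeElem (hdil : IsMinimalDilation A τ V B θ) (x : A.Elem) :
    hdil.compressionₗ (includeElem V hdil.subset x) = x :=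
  Subtype.ext (compression_extendByZero V _)

theorem proj_mul_includeElem (hdil : IsMinimalDilation A τ V B θ) (x : A.Elem) :
    hdil.proj * includeElem V hdil.subset x = includeElem V hdil.subset x :=
  Subtype.ext (by
    have := extendByZero_mul V 1 (x : H →L[ℂ] H)
    rw [one_mul, extendByZero_one, ← hdil.coe_proj] at this
    exact this.symm)

theorem compressionₗ_proj_mul_mul_proj (hdil : IsMinimalDilation A τ V B θ) (z : B.Elem) :
    hdil.compressionₗ (hdil.proj * z * hdil.proj) = hdil.compressionₗ z := by
  rw [← includeElem_compressionₗ, compressionₗ_includeElem]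

/-- The compression as a completely positive map from `B` to `A`. It is multiplicative on the corner
`p B p`, and the positive square root of a positive matrix over that corner again has entries
there. -/
noncomputable def compressionCP (hdil : IsMinimalDilation A τ V B θ) : B.Elem →CP A.Elem where
  toLinearMap := hdil.compressionₗ
  map_cstarMatrix_nonneg' k M hM := by
    let P : CStarMatrix (Fin k) (Fin k) B.Elem :=
      CStarMatrix.ofMatrix (Matrix.diagonal fun _ => hdil.proj)
    have hmulP : ∀ (N : CStarMatrix (Fin k) (Fin k) B.Elem) i j, (N * P) i j = N i j * hdil.proj :=
      fun N i j => Matrix.mul_diagonal (fun _ => hdil.proj) N i j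
    have hPmul : ∀ (N : CStarMatrix (Fin k) (Fin k) B.Elem) i j, (P * N) i j = hdil.proj * N i j :=
      fun N i j => Matrix.diagonal_mul (fun _ => hdil.proj) N i j
    have hPP : P * P = P := by
      ext1 i j
      rw [hmulP]
      by_cases h : i = j
      · subst h
        simp [P, hdil.proj_mul_self]
      · simp [P, h]
    have hPs : star P = P := by
      ext1 i j
      rw [CStarMatrix.star_apply]
      by_cases h : i = j
      · subst h
        simp [P, hdil.star_proj]
      · simp [P, h, Ne.symm h]
    let Q := P * M * P
    have hQ : 0 ≤ Q := IsSelfAdjoint.conjugate_nonneg hM hPs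
    have hPQ : P * Q = Q := by simp only [Q, ← mul_assoc, hPP]
    have hQP : Q * P = Q := by simp only [Q, mul_assoc, hPP]
    -- `M` and its entrywise compression `Q` to the corner have the same image.
    obtain ⟨s, hs, hss⟩ := CStarAlgebra.exists_isSelfAdjoint_mul_self_eq hQ
    have hsP : s * P = s := by
      have h : star (s * P - s) * (s * P - s) = P * (s * s) * P - P * (s * s) - s * s * P + s * s := by
        rw [star_sub, star_mul, hs, hPs]
        noncomm_ring
      rw [← sub_eq_zero, ← CStarRing.star_mul_self_eq_zero_iff, h, hss, hPQ, hQP]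
      simp
    have hM' : M.map hdil.compressionₗ =
        star (s.map hdil.compressionₗ) * s.map hdil.compressionₗ := by
      ext1 i j
      have hij : hdil.compressionₗ (M i j) = hdil.compressionₗ ((s * P * s) i j) := by
        rw [hsP, hss]
        simp only [Q]
        rw [hmulP, hPmul, compressionₗ_proj_mul_mul_proj]
      rw [CStarMatrix.map_apply, hij, CStarMatrix.mul_apply, CStarMatrix.mul_apply, map_sum]
      refine Finset.sum_congr rfl fun l _ => ?_
      rw [hmulP, compressionₗ_mul_proj_mul, CStarMatrix.star_apply, CStarMatrix.map_apply,
        CStarMatrix.map_apply, star_compressionₗ, ← CStarMatrix.star_apply, hs]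
    rw [hM']
    exact star_mul_self_nonneg _

end IsMinimalDilation

/-! ### The increasing projections of a minimal dilation -/

namespace IsMinimalDilation

open Filter Topology

variable {H K : Type*} [NormedAddCommGroup H] [InnerProductSpace ℂ H] [CompleteSpace H]
  [NormedAddCommGroup K] [InnerProductSpace ℂ K] [CompleteSpace K]
  {A : VonNeumannAlgebra H} {τ : A.Elem → A.Elem} {V : H →ₗᵢ[ℂ] K} {B : VonNeumannAlgebra K}
  {θ : B.Elem →⋆ₐ[ℂ] B.Elem}

theorem _root_.StarAlgHom.pow_apply_eq_iterate {M : Type*} [CStarAlgebra M] (θ : M →⋆ₐ[ℂ] M)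
    (n : ℕ) (x : M) : (θ ^ n) x = θ^[n] x := by
  induction n generalizing x with
  | zero => rfl
  | succ n ih => rw [pow_succ, Function.iterate_succ_apply, ← ih]; rfl

theorem _root_.StarAlgHom.pow_add_apply {M : Type*} [CStarAlgebra M] (θ : M →⋆ₐ[ℂ] M)
    (m n : ℕ) (x : M) : (θ ^ (m + n)) x = (θ ^ m) ((θ ^ n) x) := by
  rw [pow_add]; rfl

theorem proj_mul_pow_mul_proj (hdil : IsMinimalDilation A τ V B θ) (n : ℕ) (x : A.Elem) :
    hdil.proj * (θ ^ n) (includeElem V hdil.subset x) * hdil.proj =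
      includeElem V hdil.subset (τ^[n] x) :=
  Subtype.ext (by
    rw [StarAlgHom.pow_apply_eq_iterate]
    simpa [coe_proj] using! (hdil.dilation n x).symm)

theorem apply_proj_mul_proj (hdil : IsMinimalDilation A τ V B θ) (hτ : τ 1 = 1) :
    θ hdil.proj * hdil.proj = hdil.proj := by
  have h1 : hdil.proj * θ hdil.proj * hdil.proj = hdil.proj := by
    have := hdil.proj_mul_pow_mul_proj 1 1
    rw [pow_one, Function.iterate_one, hτ] at this
    exact this
  have h2 : star (θ hdil.proj * hdil.proj - hdil.proj) * (θ hdil.proj * hdil.proj - hdil.proj) =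
      hdil.proj * (θ hdil.proj * θ hdil.proj) * hdil.proj - hdil.proj * θ hdil.proj *
        (hdil.proj * 1) - hdil.proj * θ hdil.proj * hdil.proj + hdil.proj * hdil.proj := by
    rw [star_sub, star_mul, ← map_star, hdil.star_proj]
    noncomm_ring
  rw [← sub_eq_zero, ← CStarRing.star_mul_self_eq_zero_iff, h2, ← map_mul, hdil.proj_mul_self,
    mul_one, h1]
  simp

/-- The projections `θⁿ(p)`, which increase to the identity. -/
noncomputable def projSeq (hdil : IsMinimalDilation A τ V B θ) (n : ℕ) : B.Elem :=
  (θ ^ n) hdil.proj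

theorem star_projSeq (hdil : IsMinimalDilation A τ V B θ) (n : ℕ) :
    star (hdil.projSeq n) = hdil.projSeq n := by
  rw [projSeq, ← map_star, star_proj]

theorem projSeq_mul_of_le (hdil : IsMinimalDilation A τ V B θ) (hτ : τ 1 = 1) {n m : ℕ}
    (hnm : n ≤ m) : hdil.projSeq m * hdil.projSeq n = hdil.projSeq n := by
  induction m, hnm using Nat.le_induction with
  | base => rw [projSeq, ← map_mul, proj_mul_self]
  | succ m hm ih =>
    have h : hdil.projSeq (m + 1) * hdil.projSeq m = hdil.projSeq m := by
      rw [projSeq, projSeq, StarAlgHom.pow_add_apply, pow_one, ← map_mul,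
        hdil.apply_proj_mul_proj hτ]
    rw [← ih, ← mul_assoc, h]

theorem mul_projSeq_of_le (hdil : IsMinimalDilation A τ V B θ) (hτ : τ 1 = 1) {n m : ℕ}
    (hnm : n ≤ m) : hdil.projSeq n * hdil.projSeq m = hdil.projSeq n := by
  have := congr(star $(hdil.projSeq_mul_of_le hτ hnm))
  rwa [star_mul, star_projSeq, star_projSeq] at this

theorem projSeq_mul_pow_mul_projSeq (hdil : IsMinimalDilation A τ V B θ) (n : ℕ) (z : B.Elem) :
    hdil.projSeq n * (θ ^ n) z * hdil.projSeq n =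
      (θ ^ n) (includeElem V hdil.subset (hdil.compressionₗ z)) := by
  rw [includeElem_compressionₗ, map_mul, map_mul, projSeq]

/-- Minimality of the space: the ranges of the projections `θⁿ(p)` span a dense subspace. -/
theorem dense_iSup_range_projSeq (hdil : IsMinimalDilation A τ V B θ) :
    Dense ((⨆ n, (hdil.projSeq n : K →L[ℂ] K).range : Submodule ℂ K) : Set K) := by
  rw [Submodule.dense_iff_topologicalClosure_eq_top, eq_top_iff, ← hdil.dense]
  refine Submodule.topologicalClosure_mono (Submodule.span_le.2 ?_)
  rintro _ ⟨n, x, h, rfl⟩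
  refine Submodule.mem_iSup_of_mem n ?_
  cases n with
  | zero =>
    refine ⟨V h, ?_⟩
    change (hdil.proj : K →L[ℂ] K) (V h) = V h
    simp [coe_proj, rangeProj, V.adjoint_apply_self]
  | succ n =>
    refine ⟨dilationVector V hdil.subset θ x h (n + 1), ?_⟩
    have : hdil.projSeq (n + 1) * θ^[n + 1] (includeElem V hdil.subset (x (n + 1))) =
        θ^[n + 1] (includeElem V hdil.subset (x (n + 1))) := by
      rw [← StarAlgHom.pow_apply_eq_iterate, projSeq, ← map_mul, proj_mul_includeElem]
    rw [dilationVector]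
    exact congr(($this : K →L[ℂ] K) _)

theorem norm_le_of_forall_projSeq (hdil : IsMinimalDilation A τ V B θ) (hτ : τ 1 = 1)
    {z : K →L[ℂ] K} {C : ℝ} (hC : 0 ≤ C)
    (hz : ∀ n, ‖(hdil.projSeq n : K →L[ℂ] K) * z * hdil.projSeq n‖ ≤ C) : ‖z‖ ≤ C :=
  ContinuousLinearMap.opNorm_le_of_forall_compression_le
    (q := fun n => (hdil.projSeq n : K →L[ℂ] K))
    (fun n => congr(($(hdil.star_projSeq n) : K →L[ℂ] K)))
    (fun _ _ hnm => congr(($(hdil.projSeq_mul_of_le hτ hnm) : K →L[ℂ] K)))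
    hdil.dense_iSup_range_projSeq hC hz

theorem eq_of_forall_projSeq (hdil : IsMinimalDilation A τ V B θ) (hτ : τ 1 = 1)
    {y z : K →L[ℂ] K}
    (h : ∀ n, (hdil.projSeq n : K →L[ℂ] K) * y * hdil.projSeq n =
      (hdil.projSeq n : K →L[ℂ] K) * z * hdil.projSeq n) : y = z := by
  rw [← sub_eq_zero, ← norm_le_zero_iff]
  exact hdil.norm_le_of_forall_projSeq hτ le_rfl fun n => by
    rw [mul_sub, sub_mul, h n, sub_self, norm_zero]

/-! ### The compression is isometric on the peripheral space -/

theorem norm_compressionₗ_le (hdil : IsMinimalDilation A τ V B θ) (z : B.Elem) :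
    ‖hdil.compressionₗ z‖ ≤ ‖z‖ := by
  refine ContinuousLinearMap.opNorm_le_bound _ (norm_nonneg _) fun h => ?_
  have hV : ‖V.toContinuousLinearMap.adjoint‖ ≤ 1 := by
    rw [LinearIsometryEquiv.norm_map]
    exact V.norm_toContinuousLinearMap_le
  calc ‖V.toContinuousLinearMap.adjoint ((z : K →L[ℂ] K) (V h))‖
      ≤ 1 * ‖(z : K →L[ℂ] K) (V h)‖ := ContinuousLinearMap.le_of_opNorm_le _ hV _
    _ ≤ ‖z‖ * ‖h‖ := by
      rw [one_mul, ← V.norm_map h]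
      exact (z : K →L[ℂ] K).le_opNorm _

theorem norm_includeElem_le (hdil : IsMinimalDilation A τ V B θ) (x : A.Elem) :
    ‖includeElem V hdil.subset x‖ ≤ ‖x‖ := by
  refine ContinuousLinearMap.opNorm_le_bound _ (norm_nonneg _) fun v => ?_
  have hV : ‖V.toContinuousLinearMap.adjoint‖ ≤ 1 := by
    rw [LinearIsometryEquiv.norm_map]
    exact V.norm_toContinuousLinearMap_le
  calc ‖V ((x : H →L[ℂ] H) (V.toContinuousLinearMap.adjoint v))‖
      ≤ ‖x‖ * ‖V.toContinuousLinearMap.adjoint v‖ := by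
        rw [V.norm_map]
        exact (x : H →L[ℂ] H).le_opNorm _
    _ ≤ ‖x‖ * (1 * ‖v‖) := by
      gcongr
      exact ContinuousLinearMap.le_of_opNorm_le _ hV _
    _ = ‖x‖ * ‖v‖ := by rw [one_mul]

theorem norm_projSeq_le_one (hdil : IsMinimalDilation A τ V B θ) (n : ℕ) :
    ‖hdil.projSeq n‖ ≤ 1 :=
  (NonUnitalStarAlgHom.norm_apply_le (θ ^ n) _).trans <|
    (hdil.norm_includeElem_le 1).trans ContinuousLinearMap.norm_id_le

/-- For every `m ≥ n`, compressing `θᵐ(z)` by the smaller projection `θⁿ(p)` gives at most the norm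
of `θᵐ(p) θᵐ(z) θᵐ(p) = θᵐ(p z p)`. -/
theorem norm_projSeq_mul_pow_mul_projSeq_le (hdil : IsMinimalDilation A τ V B θ) (hτ : τ 1 = 1)
    {n m : ℕ} (hnm : n ≤ m) (z : B.Elem) :
    ‖hdil.projSeq n * (θ ^ m) z * hdil.projSeq n‖ ≤ ‖hdil.compressionₗ z‖ := by
  have h : hdil.projSeq n * (θ ^ m) z * hdil.projSeq n =
      hdil.projSeq n * (θ ^ m) (includeElem V hdil.subset (hdil.compressionₗ z)) *
        hdil.projSeq n := by
    rw [← projSeq_mul_pow_mul_projSeq]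
    conv_lhs => rw [← hdil.mul_projSeq_of_le hτ hnm]
    conv_lhs => enter [2]; rw [hdil.mul_projSeq_of_le hτ hnm, ← hdil.projSeq_mul_of_le hτ hnm]
    simp only [mul_assoc]
  rw [h]
  calc _ ≤ ‖hdil.projSeq n‖ * ‖(θ ^ m) (includeElem V hdil.subset (hdil.compressionₗ z))‖ *
        ‖hdil.projSeq n‖ := norm_mul₃_le
    _ ≤ 1 * ‖hdil.compressionₗ z‖ * 1 := by
      gcongr
      · exact hdil.norm_projSeq_le_one n
      · exact (NonUnitalStarAlgHom.norm_apply_le (θ ^ m) _).trans (hdil.norm_includeElem_le _)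
      · exact hdil.norm_projSeq_le_one n
    _ = _ := by ring

/-- The compression is isometric on `P(θ)`. By recurrence `z` is a cluster point of its orbit, so
the compressions of `z` by the projections `θⁿ(p)` inherit the bound by `‖p z p‖` from the
compressions of `θᵐ(z)`, `m ≥ n`. -/
theorem norm_compressionₗ_of_mem_peripheralSpace (hdil : IsMinimalDilation A τ V B θ)
    (hτ : τ 1 = 1) {z : B.Elem} (hz : z ∈ peripheralSpace θ) : ‖hdil.compressionₗ z‖ = ‖z‖ := by
  have hcont : Continuous hdil.compressionₗ :=
    AddMonoidHomClass.continuous_of_bound _ 1 fun z => by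
      simpa using hdil.norm_compressionₗ_le z
  refine closure_minimal (t := {z : B.Elem | ‖hdil.compressionₗ z‖ = ‖z‖}) (fun z hz => ?_)
    (isClosed_eq hcont.norm continuous_norm) hz
  refine (hdil.norm_compressionₗ_le z).antisymm ?_
  refine hdil.norm_le_of_forall_projSeq hτ (norm_nonneg _) fun n => ?_
  have hrec := mapClusterPt_iterate_of_mem_span (θ : B.Elem →ₗ[ℂ] B.Elem) hz
  have hclosed : IsClosed {w : B.Elem |
      ‖hdil.projSeq n * w * hdil.projSeq n‖ ≤ ‖hdil.compressionₗ z‖} :=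
    isClosed_le (by fun_prop) (by fun_prop)
  refine hclosed.mem_of_mapClusterPt hrec ?_
  filter_upwards [eventually_ge_atTop n] with m hm
  have hpow : ((θ : B.Elem →ₗ[ℂ] B.Elem) ^ m) z = (θ ^ m) z := by
    rw [Module.End.pow_apply, StarAlgHom.pow_apply_eq_iterate]
    rfl
  simpa only [Set.mem_ofPred_eq, hpow] using hdil.norm_projSeq_mul_pow_mul_projSeq_le hτ hm z

/-! ### Lifting peripheral eigenvectors -/

/-- The dilation identity passes from `A` to `B` because `p ≤ θ(p)`. -/
theorem compressionₗ_intertwines (hdil : IsMinimalDilation A τ V B θ) (hτ : τ 1 = 1) (z : B.Elem) :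
    hdil.compressionₗ (θ z) = τ (hdil.compressionₗ z) := by
  have h0 := hdil.apply_proj_mul_proj hτ
  have h0' : hdil.proj * θ hdil.proj = hdil.proj := by
    have := congr(star $h0)
    rwa [star_mul, ← map_star, star_proj] at this
  have h := hdil.proj_mul_pow_mul_proj 1 (hdil.compressionₗ z)
  rw [includeElem_compressionₗ, pow_one, Function.iterate_one, map_mul, map_mul, ← mul_assoc,
    ← mul_assoc, h0', mul_assoc, h0] at h
  rw [← hdil.compressionₗ_includeElem (τ _), ← h, compressionₗ_proj_mul_mul_proj]

/-- Every peripheral eigenvector `x` of `τ` is the compression of one of `θ`: the operators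
`c⁻ⁿ θⁿ(x)` are the compressions by `θⁿ(p)` of any of their weak cluster points. -/
theorem exists_eigenvector_compressionₗ_eq (hdil : IsMinimalDilation A τ V B θ) (hτ : τ 1 = 1)
    (hsmul : ∀ (c : ℂ) x, τ (c • x) = c • τ x)
    {c : ℂ} (hc : ‖c‖ = 1) {x : A.Elem} (hx : τ x = c • x) :
    ∃ z : B.Elem, θ z = c • z ∧ hdil.compressionₗ z = x := by
  have hc0 : c ≠ 0 := by
    rintro rfl
    simp at hc
  have hxn : ∀ n, τ^[n] x = c ^ n • x := fun n => by
    induction n with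
    | zero => simp
    | succ n ih => rw [Function.iterate_succ_apply', ih, hsmul, hx, smul_smul, pow_succ]
  let y : ℕ → B.Elem := fun n => c⁻¹ ^ n • (θ ^ n) (includeElem V hdil.subset x)
  have hy : ∀ n m, n ≤ m → hdil.projSeq n * y m * hdil.projSeq n = y n := by
    intro n m hnm
    obtain ⟨k, rfl⟩ := Nat.exists_eq_add_of_le hnm
    simp only [y, mul_smul_comm, smul_mul_assoc]
    rw [StarAlgHom.pow_add_apply, projSeq, ← map_mul, ← map_mul, proj_mul_pow_mul_proj, hxn]
    have : includeElem V hdil.subset (c ^ k • x) = c ^ k • includeElem V hdil.subset x :=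
      Subtype.ext (extendByZero_smul V _ _)
    rw [this, map_smul, smul_smul, pow_add, mul_assoc, ← mul_pow, inv_mul_cancel₀ hc0, one_pow,
      mul_one]
  have hbound : ∀ n, ‖(y n : K →L[ℂ] K)‖ ≤ ‖x‖ := fun n => by
    change ‖y n‖ ≤ _
    rw [norm_smul, norm_pow, norm_inv, hc, inv_one, one_pow, one_mul]
    exact (NonUnitalStarAlgHom.norm_apply_le (θ ^ n) _).trans (hdil.norm_includeElem_le _)
  obtain ⟨z, hz⟩ := ContinuousLinearMap.exists_tendsto_inner_hyperfilter _ _ hbound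
  have hzy : ∀ n, (hdil.projSeq n : K →L[ℂ] K) * z * hdil.projSeq n = y n := by
    intro n
    have hsa : ContinuousLinearMap.adjoint (hdil.projSeq n : K →L[ℂ] K) = hdil.projSeq n :=
      congr(($(hdil.star_projSeq n) : K →L[ℂ] K))
    ext v
    refine ext_inner_right ℂ fun w => ?_
    have h1 := hz ((hdil.projSeq n : K →L[ℂ] K) v) ((hdil.projSeq n : K →L[ℂ] K) w)
    have h2 : ∀ u : K →L[ℂ] K, inner ℂ (u ((hdil.projSeq n : K →L[ℂ] K) v))
        ((hdil.projSeq n : K →L[ℂ] K) w) =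
        inner ℂ (((hdil.projSeq n : K →L[ℂ] K) * u * hdil.projSeq n) v) w := fun u => by
      rw [← ContinuousLinearMap.adjoint_inner_left, hsa]
      rfl
    simp only [h2] at h1
    refine tendsto_nhds_unique h1 (tendsto_const_nhds.congr' ?_)
    filter_upwards [Nat.hyperfilter_le_atTop (eventually_ge_atTop n)] with m hm
    have h3 : (y n : K →L[ℂ] K) = hdil.projSeq n * y m * hdil.projSeq n :=
      congrArg Subtype.val (hy n m hm).symm
    rw [h3]
  have hzB : z ∈ B := by
    rw [← B.commutant_commutant, VonNeumannAlgebra.mem_commutant_iff]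
    intro g hg
    rw [VonNeumannAlgebra.mem_commutant_iff] at hg
    refine hdil.eq_of_forall_projSeq hτ fun n => ?_
    have hq := hg _ (hdil.projSeq n).2
    have hyn := hg _ (y n).2
    calc (hdil.projSeq n : K →L[ℂ] K) * (g * z) * hdil.projSeq n
        = g * (hdil.projSeq n * z * hdil.projSeq n) := by
          simp only [← mul_assoc, hq]
      _ = (hdil.projSeq n * z * hdil.projSeq n) * g := by rw [hzy, hyn]
      _ = hdil.projSeq n * (z * g) * hdil.projSeq n := by
          simp only [mul_assoc, hq]
  have hzy' : ∀ n, hdil.projSeq n * ⟨z, hzB⟩ * hdil.projSeq n = y n := fun n =>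
    Subtype.ext (hzy n)
  refine ⟨⟨z, hzB⟩, ?_, ?_⟩
  · have hsucc : ∀ n, hdil.projSeq (n + 1) * θ ⟨z, hzB⟩ * hdil.projSeq (n + 1) =
        hdil.projSeq (n + 1) * (c • ⟨z, hzB⟩) * hdil.projSeq (n + 1) := by
      intro n
      have hq : hdil.projSeq (n + 1) = θ (hdil.projSeq n) := by
        rw [projSeq, projSeq, add_comm, StarAlgHom.pow_add_apply, pow_one]
      rw [mul_smul_comm, smul_mul_assoc, hzy', hq, ← map_mul, ← map_mul, hzy']
      simp only [y]
      rw [map_smul, smul_smul, add_comm n 1, StarAlgHom.pow_add_apply, pow_one, pow_add, pow_one,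
        ← mul_assoc, mul_inv_cancel₀ hc0, one_mul]
    refine Subtype.ext (hdil.eq_of_forall_projSeq hτ fun n => ?_)
    -- The case of `n` follows from that of `n + 1`, as `θⁿ(p) ≤ θⁿ⁺¹(p)`.
    have h := congr(hdil.projSeq n * $(hsucc n) * hdil.projSeq n)
    simp only [mul_assoc, hdil.projSeq_mul_of_le hτ n.le_succ] at h
    simp only [← mul_assoc, hdil.mul_projSeq_of_le hτ n.le_succ] at h
    exact congr(($h : K →L[ℂ] K))
  · have h0 : hdil.proj * ⟨z, hzB⟩ * hdil.proj = includeElem V hdil.subset x :=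
      (hzy' 0).trans (by simp only [y, pow_zero, one_smul]; rfl)
    rw [← compressionₗ_proj_mul_mul_proj, h0, compressionₗ_includeElem]

/-- The compression maps `P(θ)` onto `P(τ)`. -/
theorem map_peripheralSpace (hdil : IsMinimalDilation A τ V B θ) (hτ : τ 1 = 1)
    (hsmul : ∀ (c : ℂ) x, τ (c • x) = c • τ x) :
    (peripheralSpace θ).map hdil.compressionₗ = peripheralSpace τ := by
  have hcont : Continuous hdil.compressionₗ :=
    AddMonoidHomClass.continuous_of_bound _ 1 fun z => by
      simpa using hdil.norm_compressionₗ_le z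
  refine le_antisymm ?_ (Submodule.topologicalClosure_minimal _ ?_ ?_)
  · rintro _ ⟨z, hz, rfl⟩
    refine map_mem_closure hcont hz fun z hz => ?_
    suffices h : Submodule.span ℂ {x : B.Elem | ∃ c : ℂ, ‖c‖ = 1 ∧ θ x = c • x} ≤
        (Submodule.span ℂ {x : A.Elem | ∃ c : ℂ, ‖c‖ = 1 ∧ τ x = c • x}).comap
          hdil.compressionₗ from h hz
    rw [Submodule.span_le]
    rintro z ⟨c, hc, hz⟩
    exact Submodule.subset_span ⟨c, hc, by rw [← hdil.compressionₗ_intertwines hτ, hz, map_smul]⟩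
  · rw [Submodule.span_le]
    rintro x ⟨c, hc, hx⟩
    obtain ⟨z, hz, rfl⟩ := hdil.exists_eigenvector_compressionₗ_eq hτ hsmul hc hx
    exact ⟨z, subset_closure (Submodule.subset_span ⟨c, hc, hz⟩), rfl⟩
  -- The image is complete, being isometric to the complete space `P(θ)`.
  · have hiso : Isometry fun z : peripheralSpace θ => hdil.compressionₗ z :=
      AddMonoidHomClass.isometry_of_norm
        (hdil.compressionₗ ∘ₗ (peripheralSpace θ).subtype) fun z =>
          hdil.norm_compressionₗ_of_mem_peripheralSpace hτ z.2
    have : CompleteSpace (peripheralSpace θ) :=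
      (Submodule.isClosed_topologicalClosure _).completeSpace_coe
    convert hiso.isClosedEmbedding.isClosed_range using 1
    ext x
    simp

end IsMinimalDilation

theorem theorem2p3 {H K : Type*}
    [NormedAddCommGroup H] [InnerProductSpace ℂ H] [CompleteSpace H]
    [NormedAddCommGroup K] [InnerProductSpace ℂ K] [CompleteSpace K]
    (A : VonNeumannAlgebra H) (τ : A.Elem →CP A.Elem) (hτ_one : τ 1 = 1)
    (hτ_normal : ScottContinuous τ)
    (V : H →ₗᵢ[ℂ] K) (B : VonNeumannAlgebra K) (θ : B.Elem →⋆ₐ[ℂ] B.Elem)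
    (hdil : IsMinimalDilation A τ V B θ) :
    -- the compression `Φ : B → A` is well defined and completely positive
    ∃ Φ : B.Elem →CP A.Elem,
      (∀ z : B.Elem, (Φ z : H →L[ℂ] H) = compression V z) ∧
      -- `P(θ)` is a norm-closed unital `⋆`-subalgebra `S` of `B`
      ∃ S : StarSubalgebra ℂ B.Elem, (S : Set B.Elem) = peripheralSpace θ ∧
        -- `Φ` restricts to an isometric linear bijection `T` of `P(θ)` onto `P(τ)`
        ∃ T : S ≃ₗᵢ[ℂ] peripheralSpace τ,
          (∀ z : S, (T z : A.Elem) = Φ z) ∧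
          IsUnitalCStarProduct (peripheralSpace τ)
            (fun x y => T (T.symm x * T.symm y)) := by
  have hmap := hdil.map_peripheralSpace hτ_one fun c x => map_smul τ c x
  let S := peripheralStarSubalgebra θ
  have hS : IsClosed (S : Set B.Elem) := Submodule.isClosed_topologicalClosure _
  let T₀ : S →ₗ[ℂ] peripheralSpace τ :=
    (hdil.compressionₗ ∘ₗ S.subtype.toAlgHom.toLinearMap).codRestrict _ fun z =>
      hmap ▸ Submodule.mem_map_of_mem z.2
  let T : S ≃ₗᵢ[ℂ] peripheralSpace τ := LinearIsometryEquiv.ofSurjective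
    ⟨T₀, fun z => hdil.norm_compressionₗ_of_mem_peripheralSpace hτ_one z.2⟩ fun x => by
      obtain ⟨z, hz, hzx⟩ := hmap.ge x.2
      exact ⟨⟨z, hz⟩, Subtype.ext hzx⟩
  exact ⟨hdil.compressionCP, fun _ => rfl, S, rfl, T, fun _ => rfl,
    isUnitalCStarProduct_of_linearIsometryEquiv _ T hdil.compressionₗ_one fun z =>
      (hdil.star_compressionₗ z).symm⟩
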